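/- Let $n\ge 0$, let $\mathbb F=\mathbb Q(q,t)$ and $\mathbb K=\mathbb Q(q,t,a)$ be fields of rational functions, and write $|\alpha|=\alpha_1+\cdots+\alpha_n$ for a composition $\alpha\in\mathcal C_n=(\mathbb Z_{\ge 0})^n$. For $v\in\mathbb Z^n$ put $$\overline v_i:=q^{v_i}t^{-k_i(v)},\qquad k_i(v):=\#\{k<i\mid v_k\ge v_i\}+\#\{k>i\mid v_k>v_i\},$$ $\overline v:=(\overline v_1,\ldots,\overline v_n)\in\mathbb F^n$, $\overline v^{-1}:=(\overline v_1^{-1},\ldots,\overline v_n^{-1})$, $w_0v:=(v_n,\ldots,v_1)$ and $\widetilde v:=\overline{-w_0v}$; let $\tau:=(1,t^{-1},\ldots,t^{1-n})$. For $\alpha\in\mathcal C_n$, the non-symmetric interpolation Macdonald polynomial $G_\alpha(x)=G_\alpha(x;q,t)\in\mathbb F[x_1,\ldots,x_n]$ is the unique polynomial of degree at most $|\alpha|$ such that $G_\alpha(\overline\beta)=0$ for all $\beta\in\mathcal C_n$ with $|\beta|\le|\alpha|$, $\beta\ne\alpha$, and such that the coefficient of $x^\alpha$ in $G_\alpha$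 is $1$. Put $K_\alpha(x):=G_\alpha(x)/G_\alpha(a\tau)\in\mathbb K[x_1,\ldots,x_n]$. **Theorem C.** For every $\alpha\in\mathcal C_n$: the polynomial $G_\alpha$ exists and is unique, and $G_\alpha(a\tau)\ne 0$; there is a unique polynomial $O_\alpha(x)\in\mathbb K[x_1,\ldots,x_n]$ of degree at most $|\alpha|$ such that $$O_\alpha(\overline\beta^{-1})=\frac{G_\beta(a\widetilde\alpha)}{G_\beta(a\tau)}\qquad\text{for all }\beta\in\mathcal C_n;$$ and, with $w_0x=(x_n,\ldots,x_1)$, $$O_\alpha(x)=K_\alpha(t^{1-n}a\,w_0x)=\frac{G_\alpha(t^{1-n}a\,w_0x)}{G_\alpha(a\tau)}.$$ -/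

import Mathlib

namespace InterpolationMacdonald

/-- The field `𝔽 = ℚ(q, t)` of rational functions in two indeterminates. -/
abbrev F : Type := FractionRing (MvPolynomial (Fin 2) ℚ)

/-- The field `𝕂 = ℚ(q, t, a) = 𝔽(a)`. -/
abbrev K : Type := RatFunc F

/-- The indeterminate `q` of `ℚ(q, t)`. -/
noncomputable def q : F := algebraMap (MvPolynomial (Fin 2) ℚ) F (MvPolynomial.X 0)

/-- The indeterminate `t` of `ℚ(q, t)`. -/
noncomputable def t : F := algebraMap (MvPolynomial (Fin 2) ℚ) F (MvPolynomial.X 1)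

/-- The indeterminate `a` of `ℚ(q, t, a)`. -/
noncomputable def a : K := RatFunc.X

variable {n : ℕ}

/-- `k_i(v) = #{k < i | v_k ≥ v_i} + #{k > i | v_k > v_i}`. -/
def kNum (v : Fin n → ℤ) (i : Fin n) : ℕ :=
  (Finset.univ.filter fun k => k < i ∧ v i ≤ v k).card +
    (Finset.univ.filter fun k => i < k ∧ v i < v k).card

/-- The point `v̄` of `𝔽ⁿ`, with coordinates `q ^ v_i * t ^ (-k_i(v))`. -/
noncomputable def bar (v : Fin n → ℤ) : Fin n → F :=
  fun i => q ^ v i * t ^ (-(kNum v i : ℤ))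

/-- The longest element `w₀` of the symmetric group acting on integral vectors. -/
def w0 (v : Fin n → ℤ) : Fin n → ℤ := fun i => v i.rev

/-- The point `ṽ`, which is the bar of `-w₀ v`. -/
noncomputable def tilde (v : Fin n → ℤ) : Fin n → F := bar (-w0 v)

/-- A composition (vector of natural numbers) as an integral vector. -/
def toInt (α : Fin n → ℕ) : Fin n → ℤ := fun i => (α i : ℤ)

/-- The point `τ = (1, t⁻¹, …, t^(1-n))`. -/
noncomputable def tau : Fin n → F := fun i => t ^ (-((i : ℕ) : ℤ))

/-- The size `|α| = α_1 + ⋯ + α_n`. -/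
def size (α : Fin n → ℕ) : ℕ := ∑ i, α i

/-- The point `a y` of `𝕂ⁿ`, for a point `y` of `𝔽ⁿ`. -/
noncomputable def aMul (y : Fin n → F) : Fin n → K := fun i => a * algebraMap F K (y i)

/-- The defining properties of the non-symmetric interpolation Macdonald polynomial of
degree `α`: its total degree is at most `|α|`, it vanishes at `β̄` for all compositions `β ≠ α`
with `|β| ≤ |α|`, and its coefficient of `x^α` is `1`. -/
structure IsInterpolation (α : Fin n → ℕ) (g : MvPolynomial (Fin n) F) : Prop where
  totalDegree_le : g.totalDegree ≤ size α
  vanishing : ∀ β : Fin n → ℕ, size β ≤ size α → β ≠ α → MvPolynomial.eval (bar (toInt β)) g = 0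
  coeff_eq_one : g.coeff (Finsupp.equivFunOnFinite.symm α) = 1

/-- The non-symmetric interpolation Macdonald polynomial `G_α(x; q, t)`: the polynomial
with the defining properties above. -/
noncomputable def G (α : Fin n → ℕ) : MvPolynomial (Fin n) F :=
  Classical.epsilon (IsInterpolation α)

/-- The principal evaluation `G_α(aτ)`. -/
noncomputable def GatTau (α : Fin n → ℕ) : K := MvPolynomial.aeval (aMul tau) (G α)

/-- The normalized polynomial `K_α(x) = G_α(x) / G_α(aτ)`, with coefficients in `𝕂`. -/
noncomputable def KPoly (α : Fin n → ℕ) : MvPolynomial (Fin n) K :=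
  MvPolynomial.C (GatTau α)⁻¹ * MvPolynomial.map (algebraMap F K) (G α)

/-- The coordinates of `t^(1-n) a w₀ x`: the `i`-th one is `t^(1-n) a x_(n+1-i)`. -/
noncomputable def scaledReversal (n : ℕ) : Fin n → MvPolynomial (Fin n) K :=
  fun i => MvPolynomial.C (algebraMap F K (t ^ (1 - (n : ℤ))) * a) * MvPolynomial.X i.rev

/-- The defining properties of the interpolation `O`-polynomial: total degree at most `|α|`,
and its value at `β̄⁻¹` is `G_β(a α̃) / G_β(aτ)` for every composition `β`. -/
structure IsO (α : Fin n → ℕ) (p : MvPolynomial (Fin n) K) : Prop where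
  totalDegree_le : p.totalDegree ≤ size α
  eval_eq : ∀ β : Fin n → ℕ,
    MvPolynomial.eval (fun i => algebraMap F K (bar (toInt β) i)⁻¹) p =
      MvPolynomial.aeval (aMul (tilde (toInt α))) (G β) / GatTau β

/-- The interpolation `O`-polynomial `O_α(x; q, t; a)`: the polynomial with the defining
properties above. -/
noncomputable def O (α : Fin n → ℕ) : MvPolynomial (Fin n) K :=
  Classical.epsilon (IsO α)

end InterpolationMacdonald

/-!
The values of a polynomial at the multiples `s v̄` of the points `v̄` are permuted, up to
scalars, by two kinds of operators (Knop, Sahi): the raising operator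
`Φ f(x) = (xₙ - t^(1-n)) f(xₙ / q, x₁, …, xₙ₋₁)` and the Demazure–Lusztig operators `Hᵢ`.
They therefore carry the vanishing conditions defining `G_u` to those of
`(u₂, …, uₙ, u₁ + 1)` and of `sᵢ u`, and every composition is reached from `0` by these two
moves. Uniqueness comes from specializing `xₙ` to `t^(1-n)`: a polynomial that this
specialization kills is in the image of `Φ`.

By the same characterization `G_u + H₁ ⋯ Hₙ₋₁ Φ G_u = (x₁ / ū₁) G_u`, and at `aτ`, where
each `Hᵢ` acts as multiplication by `t`, this computes `(Φ G_u)(aτ)`. Since `ṽ` is the bar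
of `-w₀ v`, the operators can also be evaluated at `a ṽ`. The resulting recursions of
`G_u(a ṽ) / G_u(aτ)` turn a move of `u` into a move of `v` and are symmetric in `u` and `v`,
hence so is the quotient. As `a ṽ = t^(1-n) a w₀(v̄⁻¹)`, this symmetry says that
`K_α(t^(1-n) a w₀ x)` has the values prescribed for `O_α`, and the points `β̄⁻¹` are Zariski
dense.
-/

namespace InterpolationMacdonald

open MvPolynomial

/-! ### Multiplicative independence of the parameters -/

theorem q_ne_zero : q ≠ 0 :=
  (map_ne_zero_iff _ (IsFractionRing.injective _ F)).mpr (X_ne_zero 0)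

theorem t_ne_zero : t ≠ 0 :=
  (map_ne_zero_iff _ (IsFractionRing.injective _ F)).mpr (X_ne_zero 1)

theorem pow_mul_pow_inj {r s r' s' : ℕ} (h : q ^ r * t ^ s = q ^ r' * t ^ s') :
    r = r' ∧ s = s' := by
  have h' : (X 0 ^ r * X 1 ^ s : MvPolynomial (Fin 2) ℚ) = X 0 ^ r' * X 1 ^ s' :=
    IsFractionRing.injective _ F (by simpa only [q, t, map_mul, map_pow] using h)
  have hq := congrArg (eval ![2, 1]) h'
  have ht := congrArg (eval ![1, 2]) h'
  simp only [map_mul, map_pow, eval_X, Matrix.cons_val_zero, Matrix.cons_val_one,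
    one_pow, mul_one, one_mul] at hq ht
  have two_pow_inj : Function.Injective fun k : ℕ => (2 : ℚ) ^ k :=
    pow_right_injective₀ (by norm_num) (by norm_num)
  exact ⟨two_pow_inj hq, two_pow_inj ht⟩

theorem eq_zero_of_zpow_mul_zpow_eq_one {r s : ℤ} (h : q ^ r * t ^ s = 1) : r = 0 ∧ s = 0 := by
  have h' : q ^ r.toNat * t ^ s.toNat = q ^ (-r).toNat * t ^ (-s).toNat := by
    have hr : (r.toNat : ℤ) = r + (-r).toNat := by omega
    have hs : (s.toNat : ℤ) = s + (-s).toNat := by omega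
    simp only [← zpow_natCast]
    rw [hr, hs, zpow_add₀ q_ne_zero, zpow_add₀ t_ne_zero, mul_mul_mul_comm, h, one_mul]
  have := pow_mul_pow_inj h'
  omega

theorem zpow_mul_zpow_inj {r s r' s' : ℤ} (h : q ^ r * t ^ s = q ^ r' * t ^ s') :
    r = r' ∧ s = s' := by
  have h' : q ^ (r - r') * t ^ (s - s') = 1 := by
    rw [zpow_sub₀ q_ne_zero, zpow_sub₀ t_ne_zero, div_mul_div_comm, h, div_self]
    exact mul_ne_zero (zpow_ne_zero _ q_ne_zero) (zpow_ne_zero _ t_ne_zero)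
  have := eq_zero_of_zpow_mul_zpow_eq_one h'
  omega

theorem t_ne_one : t ≠ 1 := fun h =>
  absurd (eq_zero_of_zpow_mul_zpow_eq_one (r := 0) (s := 1) (by simpa using h)).2 one_ne_zero

/-! ### The spectral points `v̄` -/

section SpectralPoints

variable {n m : ℕ}

/-- The total order on positions in which `k_i(v)` is the rank of `i`: larger entries of `v`
come first, and ties are broken from left to right. -/
abbrev Precedes (v : Fin n → ℤ) (k i : Fin n) : Prop :=
  v i < v k ∨ v k = v i ∧ k < i

theorem kNum_eq_card (v : Fin n → ℤ) (i : Fin n) :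
    kNum v i = (Finset.univ.filter fun k => Precedes v k i).card := by
  rw [kNum, ← Finset.card_union_of_disjoint, ← Finset.filter_or]
  · congr 1
    ext k
    grind
  · rw [Finset.disjoint_filter]
    exact fun k _ h h' => lt_asymm h.1 h'.1

theorem kNum_congr {v w : Fin n → ℤ} (e : Equiv.Perm (Fin n))
    (h : ∀ k i, Precedes w k i ↔ Precedes v (e k) (e i)) (i : Fin n) :
    kNum w i = kNum v (e i) := by
  rw [kNum_eq_card, kNum_eq_card]
  exact Finset.card_equiv e (by simp only [Finset.mem_filter_univ, h, implies_true])

theorem kNum_of_antitone {v : Fin n → ℤ} (hv : Antitone v) (i : Fin n) : kNum v i = i := by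
  have h : ∀ k, Precedes v k i ↔ k < i := fun k => by
    have := @hv k i
    have := @hv i k
    grind
  rw [kNum_eq_card, Finset.filter_congr fun k _ => h k, Finset.filter_gt_eq_Iio, Fin.card_Iio]

theorem kNum_last_of_forall_le {v : Fin (m + 1) → ℤ} (hv : ∀ i, v (Fin.last m) ≤ v i) :
    kNum v (Fin.last m) = m := by
  have h : ∀ k, Precedes v k (Fin.last m) ↔ k < Fin.last m := fun k => by
    have := hv k
    grind
  rw [kNum_eq_card, Finset.filter_congr fun k _ => h k, Finset.filter_gt_eq_Iio, Fin.card_Iio,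
    Fin.val_last]

theorem kNum_castSucc_of_forall_le {v : Fin (m + 1) → ℤ} (hv : ∀ i, v (Fin.last m) ≤ v i)
    (i : Fin m) : kNum v i.castSucc = kNum (Fin.init v) i := by
  have h : ¬ Precedes v (Fin.last m) i.castSucc := by
    have := hv i.castSucc
    have := Fin.castSucc_lt_last i
    grind
  rw [kNum_eq_card, kNum_eq_card, Finset.card_filter, Finset.card_filter,
    Fin.sum_univ_castSucc, if_neg h, add_zero]
  exact Finset.sum_congr rfl fun _ _ => if_congr Iff.rfl rfl rfl

theorem kNum_neg_w0 (v : Fin n → ℤ) (i : Fin n) : kNum (-w0 v) i + kNum v i.rev + 1 = n := by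
  have reversed : kNum (-w0 v) i = (Finset.univ.filter fun k => Precedes v i.rev k).card := by
    rw [kNum_eq_card]
    refine Finset.card_equiv Fin.revPerm fun k => ?_
    simp only [Finset.mem_filter_univ, Precedes, w0, Pi.neg_apply, Fin.revPerm_apply,
      neg_lt_neg_iff, neg_inj, Fin.rev_lt_rev, eq_comm]
  have trichotomy : ∀ k, Precedes v i.rev k ∨ Precedes v k i.rev ↔ k ≠ i.rev := by grind
  rw [reversed, kNum_eq_card, ← Finset.card_union_of_disjoint, ← Finset.filter_or,
    Finset.filter_congr fun k _ => trichotomy k, Finset.filter_ne', Finset.card_erase_add_one,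
    Finset.card_univ, Fintype.card_fin]
  · exact Finset.mem_univ _
  · rw [Finset.disjoint_filter]
    grind

theorem bar_ne_zero (v : Fin n → ℤ) (i : Fin n) : bar v i ≠ 0 :=
  mul_ne_zero (zpow_ne_zero _ q_ne_zero) (zpow_ne_zero _ t_ne_zero)

theorem bar_ne_t_zpow_mul_bar (v : Fin n → ℤ) {i j : Fin n} (hv : v i ≠ v j) (r : ℤ) :
    bar v i ≠ t ^ r * bar v j := by
  intro h
  rw [bar, bar, mul_left_comm, ← zpow_add₀ t_ne_zero] at h
  exact hv (zpow_mul_zpow_inj h).1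

theorem bar_ne_t_zpow {v : Fin n → ℤ} {i : Fin n} (hv : v i ≠ 0) (r : ℤ) : bar v i ≠ t ^ r := by
  intro h
  rw [bar, ← one_mul (t ^ r), ← zpow_zero q] at h
  exact hv (zpow_mul_zpow_inj h).1

theorem bar_zero : bar (0 : Fin n → ℤ) = tau := by
  ext i
  rw [bar, kNum_of_antitone (v := 0) (fun _ _ _ => le_rfl), Pi.zero_apply, zpow_zero, one_mul, tau]

theorem tilde_zero : tilde (0 : Fin n → ℤ) = tau := by
  rw [tilde, show -w0 (0 : Fin n → ℤ) = 0 from neg_zero, bar_zero]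

theorem tilde_eq_inv_bar (v : Fin n → ℤ) (i : Fin n) :
    tilde v i = t ^ (1 - (n : ℤ)) * (bar v i.rev)⁻¹ := by
  have hk : -(kNum (-w0 v) i : ℤ) = (1 - n) + kNum v i.rev := by
    have := kNum_neg_w0 v i
    omega
  rw [tilde, bar, bar, hk, zpow_add₀ t_ne_zero, mul_inv, ← zpow_neg, ← zpow_neg, neg_neg,
    Pi.neg_apply, w0]
  ring

theorem bar_snoc_zero (w : Fin m → ℕ) :
    bar (toInt (Fin.snoc w 0 : Fin (m + 1) → ℕ)) = Fin.snoc (bar (toInt w)) (t ^ (-(m : ℤ))) := by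
  have hle : ∀ i, toInt (Fin.snoc w 0 : Fin (m + 1) → ℕ) (Fin.last m) ≤
      toInt (Fin.snoc w 0 : Fin (m + 1) → ℕ) i := fun i => by simp [toInt]
  have hinit : Fin.init (toInt (Fin.snoc w 0 : Fin (m + 1) → ℕ)) = toInt w := by
    ext i
    simp [toInt, Fin.init]
  ext i
  refine Fin.lastCases ?_ (fun i => ?_) i
  · rw [bar, kNum_last_of_forall_le hle]
    simp [toInt]
  · rw [bar, kNum_castSucc_of_forall_le hle, hinit]
    simp [toInt, bar]

/-- The map `(u₁, …, uₙ) ↦ (u₂, …, uₙ, u₁ + 1)` on (compositions and) integral vectors. -/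
def raise {A : Type*} [Add A] [One A] (u : Fin (m + 1) → A) : Fin (m + 1) → A :=
  Fin.snoc (α := fun _ => A) (Fin.tail u) (u 0 + 1)

@[simp] theorem raise_last {A : Type*} [Add A] [One A] (u : Fin (m + 1) → A) :
    raise u (Fin.last m) = u 0 + 1 :=
  Fin.snoc_last _ _

@[simp] theorem raise_castSucc {A : Type*} [Add A] [One A] (u : Fin (m + 1) → A) (i : Fin m) :
    raise u i.castSucc = u i.succ :=
  Fin.snoc_castSucc _ _ _

theorem toInt_raise (u : Fin (m + 1) → ℕ) : toInt (raise u) = raise (toInt u) := by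
  ext i
  refine Fin.lastCases ?_ (fun i => ?_) i <;> simp [toInt]

theorem size_raise (u : Fin (m + 1) → ℕ) : size (raise u) = size u + 1 := by
  rw [size, size, Fin.sum_univ_castSucc, Fin.sum_univ_succ]
  simp only [raise_last, raise_castSucc]
  ring

theorem kNum_raise (v : Fin (m + 1) → ℤ) (i : Fin (m + 1)) :
    kNum (raise v) i = kNum v (finRotate (m + 1) i) := by
  refine kNum_congr (finRotate (m + 1)) (fun k i => ?_) i
  have last_lt (j : Fin m) : ¬ Fin.last m < j.castSucc := (Fin.castSucc_lt_last j).not_gt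
  induction k using Fin.lastCases <;> induction i using Fin.lastCases <;>
    simp only [Precedes, raise_last, raise_castSucc, finRotate_apply, Fin.last_add_one,
      Fin.coeSucc_eq_succ, Fin.succ_lt_succ_iff, Fin.castSucc_lt_castSucc_iff, lt_self_iff_false,
      Fin.castSucc_lt_last, Fin.succ_pos, Fin.not_lt_zero, last_lt] <;>
    grind

theorem bar_raise_last (v : Fin (m + 1) → ℤ) : bar (raise v) (Fin.last m) = q * bar v 0 := by
  rw [bar, bar, kNum_raise, finRotate_last, raise_last, zpow_add₀ q_ne_zero, zpow_one]
  ring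

theorem bar_raise_castSucc (v : Fin (m + 1) → ℤ) (i : Fin m) :
    bar (raise v) i.castSucc = bar v i.succ := by
  rw [bar, bar, kNum_raise, finRotate_apply, Fin.coeSucc_eq_succ, raise_castSucc]

/-- The transposition of two adjacent positions. -/
abbrev adj (i : Fin m) : Equiv.Perm (Fin (m + 1)) := Equiv.swap i.castSucc i.succ

theorem adj_lt_adj_iff {i : Fin m} {j k : Fin (m + 1)} (h : ¬ (j = i.castSucc ∧ k = i.succ))
    (h' : ¬ (k = i.castSucc ∧ j = i.succ)) : adj i j < adj i k ↔ j < k := by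
  simp only [adj, Equiv.swap_apply_def]
  grind

theorem comp_adj_comp_adj {A : Type*} (w : Fin (m + 1) → A) (i : Fin m) :
    (w ∘ adj i) ∘ adj i = w := by
  ext
  simp [adj]

theorem comp_adj_eq_self {A : Type*} {w : Fin (m + 1) → A} {i : Fin m}
    (h : w i.castSucc = w i.succ) : w ∘ adj i = w := by
  ext k
  simp only [Function.comp, adj, Equiv.swap_apply_def]
  split_ifs <;> simp_all

theorem size_comp_adj (w : Fin (m + 1) → ℕ) (i : Fin m) : size (w ∘ adj i) = size w :=
  Equiv.sum_comp (adj i) w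

theorem bar_comp_adj {v : Fin (m + 1) → ℤ} {i : Fin m} (hv : v i.castSucc ≠ v i.succ) :
    bar (v ∘ adj i) = bar v ∘ adj i := by
  have key : ∀ k j, Precedes (v ∘ adj i) k j ↔ Precedes v (adj i k) (adj i j) := by
    refine fun k j => or_congr Iff.rfl (and_congr_right fun hkj => (adj_lt_adj_iff ?_ ?_).symm)
    all_goals
      rintro ⟨rfl, rfl⟩
      simp only [Function.comp, adj, Equiv.swap_apply_left, Equiv.swap_apply_right] at hkj
      simp only [hkj, ne_eq, not_true] at hv
  ext j
  simp only [bar, kNum_congr _ key, Function.comp]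

theorem bar_castSucc_of_eq {v : Fin (m + 1) → ℤ} {i : Fin m} (hv : v i.castSucc = v i.succ) :
    bar v i.castSucc = t * bar v i.succ := by
  have hk : kNum v i.succ = kNum v i.castSucc + 1 := by
    have : ∀ k, Precedes v k i.succ ↔ k = i.castSucc ∨ Precedes v k i.castSucc := fun k => by
      have : k < i.succ ↔ k = i.castSucc ∨ k < i.castSucc := by
        rw [← le_iff_eq_or_lt, Fin.le_castSucc_iff]
      grind
    rw [kNum_eq_card, kNum_eq_card, Finset.filter_congr fun k _ => this k, Finset.filter_or,
      Finset.filter_eq', if_pos (Finset.mem_univ _), Finset.singleton_union,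
      Finset.card_insert_of_notMem (by simp)]
  rw [bar, bar, hv, hk, Nat.cast_succ, neg_add, zpow_add₀ t_ne_zero, zpow_neg_one]
  field_simp [t_ne_zero]

theorem bar_castSucc_ne_bar_succ (v : Fin (m + 1) → ℤ) (i : Fin m) :
    bar v i.castSucc ≠ bar v i.succ := by
  by_cases hv : v i.castSucc = v i.succ
  · rw [bar_castSucc_of_eq hv, Ne, mul_eq_right₀ (bar_ne_zero v i.succ)]
    exact t_ne_one
  · simpa using bar_ne_t_zpow_mul_bar v hv 0

theorem exists_eq_raise {u : Fin (m + 1) → ℕ} (h : u (Fin.last m) ≠ 0) : ∃ u', u = raise u' := by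
  refine ⟨Fin.cons (u (Fin.last m) - 1) (Fin.init u), ?_⟩
  ext k
  refine Fin.lastCases ?_ (fun k => ?_) k
  · simpa using (Nat.succ_pred_eq_of_ne_zero h).symm
  · simp [Fin.init]

theorem composition_induction {P : (Fin (m + 1) → ℕ) → Prop} (zero : P 0)
    (raise : ∀ u, P u → P (raise u)) (swap : ∀ u (i : Fin m), P u → P (u ∘ adj i))
    (u : Fin (m + 1) → ℕ) : P u := by
  induction hd : size u using Nat.strong_induction_on generalizing u with
  | _ d ih =>
    have of_ne_zero : ∀ (j : Fin (m + 1)) (w : Fin (m + 1) → ℕ), size w = d → w j ≠ 0 → P w := by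
      intro j
      induction j using Fin.reverseInduction with
      | last =>
        intro w hw hj
        obtain ⟨w, rfl⟩ := exists_eq_raise hj
        exact raise w (ih _ (by rw [← hw, size_raise]; omega) w rfl)
      | cast i hi =>
        intro w hw hj
        rw [← comp_adj_comp_adj w i]
        exact swap _ i (hi _ ((size_comp_adj w i).trans hw) (by simpa [adj] using hj))
    by_cases hu : u = 0
    · exact hu ▸ zero
    · obtain ⟨j, hj⟩ := Function.ne_iff.mp hu
      exact of_ne_zero j u hd hj

end SpectralPoints

/-! ### Polynomials under linear substitutions -/

section Substitutions

variable {n m : ℕ} {σ τ R A : Type*}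

theorem dvd_aeval_sub_aeval [CommRing R] [CommRing A] [Algebra R A] {d : A} {x y : σ → A}
    (h : ∀ i, d ∣ x i - y i) (p : MvPolynomial σ R) : d ∣ aeval x p - aeval y p := by
  have heq : (Ideal.Quotient.mkₐ R (Ideal.span {d})).comp (aeval x) =
      (Ideal.Quotient.mkₐ R (Ideal.span {d})).comp (aeval y) := by
    refine algHom_ext fun i => ?_
    rw [AlgHom.comp_apply, AlgHom.comp_apply, aeval_X, aeval_X]
    exact Ideal.Quotient.eq.mpr (Ideal.mem_span_singleton.mpr (h i))
  exact Ideal.mem_span_singleton.mp (Ideal.Quotient.eq.mp (DFunLike.congr_fun heq p))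

theorem totalDegree_aeval_le [CommSemiring R] {x : σ → MvPolynomial τ R}
    (hx : ∀ i, (x i).totalDegree ≤ 1) (p : MvPolynomial σ R) :
    (aeval x p).totalDegree ≤ p.totalDegree := by
  rw [aeval_def, eval₂_eq]
  refine totalDegree_finsetSum_le fun d hd => (totalDegree_mul _ _).trans ?_
  rw [algebraMap_eq, totalDegree_C, zero_add]
  refine (totalDegree_finsetProd _ _).trans ((Finset.sum_le_sum fun i _ => ?_).trans
    (le_totalDegree hd))
  exact (totalDegree_pow _ _).trans (by simpa using Nat.mul_le_mul_left (d i) (hx i))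

theorem coeff_mapDomain_aeval_C_mul_X [CommSemiring R] (c : σ → R) {π : σ → τ}
    (hπ : Function.Injective π) (p : MvPolynomial σ R) (e : σ →₀ ℕ) :
    coeff (e.mapDomain π) (aeval (fun i => C (c i) * X (π i)) p) =
      (e.prod fun i k => c i ^ k) * coeff e p := by
  classical
  induction p using MvPolynomial.induction_on' with
  | monomial d r =>
    have : aeval (fun i => C (c i) * X (π i)) (monomial d r) =
        monomial (d.mapDomain π) (r * d.prod fun i k => c i ^ k) := by
      rw [aeval_monomial, algebraMap_eq, monomial_eq, Finsupp.prod_mapDomain_index_inj hπ, C_mul,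
        mul_assoc]
      simp only [mul_pow, Finsupp.prod, Finset.prod_mul_distrib, map_prod, map_pow]
    simp only [this, coeff_monomial, (Finsupp.mapDomain_injective hπ).eq_iff]
    split_ifs with h
    · rw [h, mul_comm]
    · rw [mul_zero]
  | add p p' hp hp' => rw [map_add, coeff_add, coeff_add, hp, hp', mul_add]

theorem totalDegree_linear_mul [CommRing R] [IsDomain R] {l p : MvPolynomial σ R}
    (hl : l.totalDegree = 1) (hp : p ≠ 0) : (l * p).totalDegree = p.totalDegree + 1 := by
  have hl0 : l ≠ 0 := by
    rintro rfl
    simp at hl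
  rw [totalDegree_mul_of_isDomain hl0 hp, hl, add_comm]

theorem totalDegree_X_sub [CommRing R] [Nontrivial R] {i : σ} {p : MvPolynomial σ R}
    (hp : p.totalDegree ≤ 1) (hi : coeff (Finsupp.single i 1) p = 0) :
    (X i - p).totalDegree = 1 := by
  refine le_antisymm ((totalDegree_sub _ _).trans (max_le (totalDegree_X i).le hp)) ?_
  simpa using le_totalDegree (p := X i - p) (s := Finsupp.single i 1) (by simp [hi])

theorem totalDegree_X_sub_C [CommRing R] [Nontrivial R] (i : σ) (b : R) :
    (X i - C b).totalDegree = 1 := by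
  refine totalDegree_X_sub (by simp) ?_
  classical rw [coeff_C, if_neg (Finsupp.single_ne_zero.mpr one_ne_zero).symm]

/-- The exponent vector of the monomial `x^α`. -/
noncomputable abbrev expo (α : Fin n → ℕ) : Fin n →₀ ℕ := Finsupp.equivFunOnFinite.symm α

theorem degree_expo (α : Fin n → ℕ) : (expo α).degree = size α :=
  Finsupp.degree_eq_sum _

theorem coeff_expo_eq_zero [CommSemiring R] {p : MvPolynomial (Fin n) R} {w : Fin n → ℕ}
    (h : p.totalDegree < size w) : coeff (expo w) p = 0 :=
  coeff_eq_zero_of_totalDegree_lt <| h.trans_eq <| (degree_expo w).symm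

/-- The specialization of the last variable to `b`. -/
noncomputable def setLast [CommRing R] (b : R) :
    MvPolynomial (Fin (m + 1)) R →ₐ[R] MvPolynomial (Fin m) R :=
  aeval (Fin.snoc X (C b))

theorem X_last_sub_C_dvd [CommRing R] (b : R) (p : MvPolynomial (Fin (m + 1)) R) :
    X (Fin.last m) - C b ∣ p - rename Fin.castSucc (setLast b p) := by
  have hsubst : (aeval (Fin.snoc (fun i => X i.castSucc) (C b)) :
      MvPolynomial (Fin (m + 1)) R →ₐ[R] _) = (rename Fin.castSucc).comp (setLast b) := by
    refine algHom_ext fun i => Fin.lastCases ?_ (fun i => ?_) i <;> simp [setLast]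
  have := dvd_aeval_sub_aeval (d := X (Fin.last m) - C b) (x := X)
    (y := Fin.snoc (α := fun _ => MvPolynomial (Fin (m + 1)) R) (fun i => X i.castSucc) (C b))
    (fun i => Fin.lastCases (by simp) (fun i => by simp) i) p
  rwa [aeval_X_left_apply, hsubst] at this

theorem totalDegree_setLast_le [CommRing R] [Nontrivial R] (b : R)
    (p : MvPolynomial (Fin (m + 1)) R) : (setLast b p).totalDegree ≤ p.totalDegree :=
  totalDegree_aeval_le (fun i => Fin.lastCases (by simp) (fun i => by simp) i) p

theorem eval_setLast [CommRing R] (b : R) (x : Fin m → R) (p : MvPolynomial (Fin (m + 1)) R) :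
    eval x (setLast b p) = eval (Fin.snoc x b) p := by
  rw [← coe_aeval_eq_eval, ← coe_aeval_eq_eval]
  have hsubst : (aeval x).comp (setLast b) = aeval (Fin.snoc x b : Fin (m + 1) → R) :=
    algHom_ext fun i => Fin.lastCases (by simp [setLast]) (fun i => by simp [setLast]) i
  exact DFunLike.congr_fun hsubst p

theorem coeff_setLast [CommRing R] [IsDomain R] (b : R) {p : MvPolynomial (Fin (m + 1)) R}
    {w : Fin m → ℕ} (hp : p.totalDegree ≤ size w) :
    coeff (expo w) (setLast b p) = coeff (expo (Fin.snoc w 0)) p := by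
  obtain ⟨k, hk⟩ := X_last_sub_C_dvd b p
  have hdeg : (p - rename Fin.castSucc (setLast b p)).totalDegree ≤ size w :=
    (totalDegree_sub _ _).trans <| max_le hp <|
      (totalDegree_rename_le _ _).trans <| (totalDegree_setLast_le b p).trans hp
  have hk_coeff : coeff (expo (Fin.snoc w 0)) k = 0 := by
    by_cases hk0 : k = 0
    · rw [hk0, coeff_zero]
    · refine coeff_expo_eq_zero ?_
      rw [hk, totalDegree_linear_mul (totalDegree_X_sub_C _ b) hk0] at hdeg
      simpa [size, Fin.sum_univ_castSucc] using hdeg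
  have hw : expo (Fin.snoc w 0 : Fin (m + 1) → ℕ) = (expo w).mapDomain Fin.castSucc := by
    ext i
    refine Fin.lastCases ?_ (fun i => ?_) i
    · rw [Finsupp.mapDomain_of_notMem_range _ _ (by simp)]
      simp
    · rw [Finsupp.mapDomain_apply (Fin.castSucc_injective m)]
      simp
  have := congrArg (coeff (expo (Fin.snoc w 0 : Fin (m + 1) → ℕ))) hk
  rw [sub_mul, coeff_sub, coeff_sub, coeff_C_mul, hk_coeff, mul_zero, sub_zero, coeff_X_mul',
    if_neg (by simp)] at this
  rw [sub_eq_zero.mp this, hw, coeff_rename_mapDomain _ (Fin.castSucc_injective m)]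

end Substitutions

/-! ### The raising operator and the interpolation problem -/

section Interpolation

variable {n m : ℕ}

/-- The point `(xₙ / q, x₁, …, xₙ₋₁)`. -/
noncomputable def shiftPoint {L : Type*} [CommRing L] [Algebra F L] (x : Fin (m + 1) → L) :
    Fin (m + 1) → L :=
  Fin.cons (algebraMap F L q⁻¹ * x (Fin.last m)) (Fin.init x)

/-- The raising operator `Φ f(x) = (xₙ - t^(1-n)) f(xₙ / q, x₁, …, xₙ₋₁)`. -/
noncomputable def phi (f : MvPolynomial (Fin (m + 1)) F) : MvPolynomial (Fin (m + 1)) F :=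
  (X (Fin.last m) - C (t ^ (-(m : ℤ)))) * aeval (shiftPoint X) f

theorem aeval_phi {L : Type*} [CommRing L] [Algebra F L] (x : Fin (m + 1) → L)
    (f : MvPolynomial (Fin (m + 1)) F) :
    aeval x (phi f) =
      (x (Fin.last m) - algebraMap F L (t ^ (-(m : ℤ)))) * aeval (shiftPoint x) f := by
  have hsubst : (aeval x).comp (aeval (shiftPoint X) : MvPolynomial (Fin (m + 1)) F →ₐ[F] _) =
      aeval (shiftPoint x) :=
    algHom_ext fun i => Fin.cases (by simp [shiftPoint]) (fun i => by simp [shiftPoint, Fin.init]) i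
  rw [phi, map_mul, map_sub, aeval_X, aeval_C]
  exact congrArg _ (DFunLike.congr_fun hsubst f)

/-- The multiple `s y` of a point `y` of `𝔽ⁿ`, over an `𝔽`-algebra. -/
noncomputable abbrev scale {L : Type*} [CommRing L] [Algebra F L] (s : L) (y : Fin n → F) :
    Fin n → L := fun i => s * algebraMap F L (y i)

theorem aeval_scale_one (y : Fin n → F) (f : MvPolynomial (Fin n) F) :
    aeval (scale (1 : F) y) f = eval y f := by
  rw [aeval_eq_eval]
  exact congrArg (fun x => eval x f) (funext fun i => one_mul (y i))

theorem aeval_scale_bar_raise_phi {L : Type*} [CommRing L] [Algebra F L] (s : L)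
    (v : Fin (m + 1) → ℤ) (f : MvPolynomial (Fin (m + 1)) F) :
    aeval (scale s (bar (raise v))) (phi f) =
      (s * algebraMap F L (q * bar v 0) - algebraMap F L (t ^ (-(m : ℤ)))) *
        aeval (scale s (bar v)) f := by
  have hshift : shiftPoint (scale s (bar (raise v))) = scale s (bar v) := by
    ext i
    refine Fin.cases ?_ (fun i => ?_) i
    · simp only [shiftPoint, Fin.cons_zero, scale, bar_raise_last]
      rw [mul_left_comm, ← map_mul, inv_mul_cancel_left₀ q_ne_zero]
    · simp only [shiftPoint, Fin.cons_succ, Fin.init, scale, bar_raise_castSucc]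
  rw [aeval_phi, hshift, ← bar_raise_last]

theorem eval_bar_raise_phi (u : Fin (m + 1) → ℕ) (f : MvPolynomial (Fin (m + 1)) F) :
    eval (bar (toInt (raise u))) (phi f) =
      (q * bar (toInt u) 0 - t ^ (-(m : ℤ))) * eval (bar (toInt u)) f := by
  rw [← aeval_scale_one, ← aeval_scale_one, toInt_raise, aeval_scale_bar_raise_phi, one_mul]
  rfl

theorem eval_bar_raise_phi_eq_zero_iff {u : Fin (m + 1) → ℕ} {f : MvPolynomial (Fin (m + 1)) F} :
    eval (bar (toInt (raise u))) (phi f) = 0 ↔ eval (bar (toInt u)) f = 0 := by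
  have hne : q * bar (toInt u) 0 ≠ t ^ (-(m : ℤ)) := by
    rw [← bar_raise_last, ← toInt_raise]
    exact bar_ne_t_zpow (by simp [toInt]; omega) _
  rw [eval_bar_raise_phi, mul_eq_zero, or_iff_right (sub_ne_zero.mpr hne)]

theorem eval_bar_phi_of_last_eq_zero {w : Fin (m + 1) → ℕ} (hw : w (Fin.last m) = 0)
    (f : MvPolynomial (Fin (m + 1)) F) : eval (bar (toInt w)) (phi f) = 0 := by
  have : bar (toInt w) (Fin.last m) = t ^ (-(m : ℤ)) := by
    rw [bar, kNum_last_of_forall_le fun i => by simp [toInt, hw]]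
    simp [toInt, hw]
  rw [phi, map_mul, map_sub, eval_X, eval_C, this, sub_self, zero_mul]

theorem totalDegree_aeval_shiftPoint_le (f : MvPolynomial (Fin (m + 1)) F) :
    (aeval (shiftPoint X) f : MvPolynomial (Fin (m + 1)) F).totalDegree ≤ f.totalDegree := by
  refine totalDegree_aeval_le (fun i => Fin.cases ?_ (fun i => ?_) i) f
  · exact (totalDegree_mul _ _).trans (by simp [algebraMap_eq])
  · simp [shiftPoint, Fin.init]

theorem totalDegree_phi_le (f : MvPolynomial (Fin (m + 1)) F) :
    (phi f).totalDegree ≤ f.totalDegree + 1 := by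
  have := totalDegree_aeval_shiftPoint_le f
  refine (totalDegree_mul _ _).trans ?_
  rw [totalDegree_X_sub_C]
  omega

theorem exists_phi_eq {g : MvPolynomial (Fin (m + 1)) F} (hg : g ≠ 0)
    (h : X (Fin.last m) - C (t ^ (-(m : ℤ))) ∣ g) :
    ∃ f : MvPolynomial (Fin (m + 1)) F, phi f = g ∧ f.totalDegree + 1 ≤ g.totalDegree := by
  obtain ⟨k, rfl⟩ := h
  let unshift : Fin (m + 1) → MvPolynomial (Fin (m + 1)) F :=
    Fin.snoc (fun i => X i.succ) (C q * X 0)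
  have hinv : (aeval (shiftPoint X)).comp (aeval unshift) =
      AlgHom.id F (MvPolynomial (Fin (m + 1)) F) := by
    refine algHom_ext fun i => Fin.lastCases ?_ (fun i => ?_) i
    · simp [shiftPoint, unshift, algebraMap_eq, ← mul_assoc, ← C_mul, q_ne_zero]
    · simp [shiftPoint, unshift, Fin.init]
  have hphi : phi (aeval unshift k) = (X (Fin.last m) - C (t ^ (-(m : ℤ)))) * k := by
    rw [phi, ← AlgHom.comp_apply, hinv, AlgHom.id_apply]
  refine ⟨aeval unshift k, hphi, ?_⟩
  rw [totalDegree_linear_mul (totalDegree_X_sub_C _ _) (right_ne_zero_of_mul hg)]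
  refine Nat.succ_le_succ (totalDegree_aeval_le (fun i => Fin.lastCases ?_ (fun i => ?_) i) k)
  · rw [show unshift (Fin.last m) = C q * X 0 from Fin.snoc_last _ _]
    exact (totalDegree_mul _ _).trans (by simp)
  · simp [unshift]

theorem coeff_raise_phi {w : Fin (m + 1) → ℕ} {f : MvPolynomial (Fin (m + 1)) F}
    (hf : f.totalDegree ≤ size w) :
    coeff (expo (raise w)) (phi f) = q⁻¹ ^ w 0 * coeff (expo w) f := by
  let shifted : MvPolynomial (Fin (m + 1)) F := aeval (shiftPoint X) f
  let π : Fin (m + 1) ≃ Fin (m + 1) := (finRotate (m + 1)).symm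
  have hπ_zero : π 0 = Fin.last m := (Equiv.symm_apply_eq _).mpr finRotate_last.symm
  have hπ_succ (i : Fin m) : π i.succ = i.castSucc :=
    (Equiv.symm_apply_eq _).mpr (by rw [finRotate_apply, Fin.coeSucc_eq_succ])
  have hsubst : shiftPoint X = fun i => C (Fin.cons (α := fun _ => F) q⁻¹ (fun _ => 1) i) *
      (X (π i) : MvPolynomial (Fin (m + 1)) F) := by
    ext1 i
    refine Fin.cases ?_ (fun i => ?_) i
    · simp [shiftPoint, hπ_zero, algebraMap_eq]
    · simp [shiftPoint, hπ_succ, Fin.init]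
  have hrot : expo (raise w) = Finsupp.single (Fin.last m) 1 + (expo w).mapDomain π := by
    ext i
    obtain ⟨i, rfl⟩ := π.surjective i
    rw [Finsupp.add_apply, Finsupp.mapDomain_apply π.injective]
    refine Fin.cases ?_ (fun i => ?_) i
    · simp [hπ_zero, add_comm]
    · simp [hπ_succ]
  have hshifted : coeff ((expo w).mapDomain π) shifted = q⁻¹ ^ w 0 * coeff (expo w) f := by
    rw [show shifted = _ from congrArg (fun x => aeval x f) hsubst,
      coeff_mapDomain_aeval_C_mul_X _ π.injective, Finsupp.prod_fintype _ _ (by simp),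
      Fin.prod_univ_succ]
    simp
  have hdeg : shifted.totalDegree < size (raise w) := by
    rw [size_raise]
    exact Nat.lt_succ_of_le ((totalDegree_aeval_shiftPoint_le f).trans hf)
  change coeff _ ((X (Fin.last m) - C _) * shifted) = _
  rw [sub_mul, coeff_sub, coeff_C_mul, coeff_expo_eq_zero hdeg, mul_zero, sub_zero, hrot,
    coeff_X_mul, hshifted]

/-- The polynomial `g` has degree at most `d`, its coefficient of `x^α` vanishes for `α ∈ S`, and
`g(ᾱ) = 0` for the other compositions `α` with `|α| ≤ d`. The uniqueness of `G_α` is the case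
`S = {α}`, and the fact that `G_α(ᾱ) ≠ 0` is the case `S = ∅`. -/
structure IsNull (S : Set (Fin n → ℕ)) (d : ℕ) (g : MvPolynomial (Fin n) F) : Prop where
  totalDegree_le : g.totalDegree ≤ d
  coeff_eq_zero : ∀ w ∈ S, coeff (expo w) g = 0
  eval_eq_zero : ∀ w ∉ S, size w ≤ d → eval (bar (toInt w)) g = 0

theorem IsNull.eq_zero_of_eq_C {S : Set (Fin n → ℕ)} {d : ℕ} {g : MvPolynomial (Fin n) F}
    (hg : IsNull S d g) (hC : g = C (coeff 0 g)) : g = 0 := by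
  have hcoeff : coeff 0 g = 0 := by
    by_cases h0 : 0 ∈ S
    · rw [show 0 = expo 0 from Finsupp.ext fun _ => rfl]
      exact hg.coeff_eq_zero 0 h0
    · have := hg.eval_eq_zero 0 h0 (by simp [size])
      rwa [hC, eval_C] at this
  rw [hC, hcoeff, C_0]

theorem size_snoc_zero (w : Fin m → ℕ) : size (Fin.snoc w 0 : Fin (m + 1) → ℕ) = size w := by
  simp [size, Fin.sum_univ_castSucc]

theorem IsNull.setLast {S : Set (Fin (m + 1) → ℕ)} {d : ℕ} (hS : ∀ w ∈ S, size w = d)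
    {g : MvPolynomial (Fin (m + 1)) F} (hg : IsNull S d g) :
    IsNull {w | Fin.snoc w 0 ∈ S} d (setLast (t ^ (-(m : ℤ))) g) where
  totalDegree_le := (totalDegree_setLast_le _ g).trans hg.totalDegree_le
  coeff_eq_zero w hw := by
    rw [coeff_setLast _ (hg.totalDegree_le.trans_eq ((hS _ hw).symm.trans (size_snoc_zero w)))]
    exact hg.coeff_eq_zero _ hw
  eval_eq_zero w hw hle := by
    rw [eval_setLast, ← bar_snoc_zero]
    exact hg.eval_eq_zero _ hw (by rwa [size_snoc_zero])

theorem IsNull.of_phi {S : Set (Fin (m + 1) → ℕ)} {d : ℕ} (hS : ∀ w ∈ S, size w = d + 1)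
    {f : MvPolynomial (Fin (m + 1)) F} (hf : f.totalDegree ≤ d) (h : IsNull S (d + 1) (phi f)) :
    IsNull {w | raise w ∈ S} d f where
  totalDegree_le := hf
  coeff_eq_zero w hw := by
    have hd : size w = d := Nat.succ_injective ((size_raise w).symm.trans (hS _ hw))
    have := h.coeff_eq_zero _ hw
    rw [coeff_raise_phi (hd ▸ hf)] at this
    exact (mul_eq_zero.mp this).resolve_left (pow_ne_zero _ (inv_ne_zero q_ne_zero))
  eval_eq_zero w hw hle :=
    eval_bar_raise_phi_eq_zero_iff.mp (h.eval_eq_zero _ hw (by rw [size_raise]; omega))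

theorem IsNull.eq_zero {S : Set (Fin n → ℕ)} {d : ℕ} (hS : ∀ w ∈ S, size w = d)
    {g : MvPolynomial (Fin n) F} (hg : IsNull S d g) : g = 0 := by
  induction n generalizing d with
  | zero => exact hg.eq_zero_of_eq_C (eq_C_of_isEmpty g)
  | succ m ihn =>
    induction d generalizing S g with
    | zero =>
      exact hg.eq_zero_of_eq_C (totalDegree_eq_zero_iff_eq_C.mp (Nat.le_zero.mp hg.totalDegree_le))
    | succ d ihd =>
      by_contra hne
      have hlast : InterpolationMacdonald.setLast (t ^ (-(m : ℤ))) g = 0 :=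
        ihn (fun w hw => (size_snoc_zero w).symm.trans (hS _ hw)) (hg.setLast hS)
      have hdvd := X_last_sub_C_dvd (t ^ (-(m : ℤ))) g
      rw [hlast, map_zero, sub_zero] at hdvd
      obtain ⟨f, rfl, hdeg⟩ := exists_phi_eq hne hdvd
      have hf : f = 0 :=
        ihd (fun w hw => Nat.succ_injective ((size_raise w).symm.trans (hS _ hw)))
          (IsNull.of_phi hS (Nat.succ_le_succ_iff.mp (hdeg.trans hg.totalDegree_le)) hg)
      exact hne (by rw [hf, phi, map_zero, mul_zero])

/-- The defining properties of `G_α`, except for the normalization. -/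
structure VanishesOff (α : Fin n → ℕ) (g : MvPolynomial (Fin n) F) : Prop where
  totalDegree_le : g.totalDegree ≤ size α
  eval_eq_zero : ∀ β, size β ≤ size α → β ≠ α → eval (bar (toInt β)) g = 0

theorem VanishesOff.eq_zero_of_coeff {α : Fin n → ℕ} {g : MvPolynomial (Fin n) F}
    (hg : VanishesOff α g) (hα : coeff (expo α) g = 0) : g = 0 :=
  IsNull.eq_zero (S := {α}) (by simp)
    ⟨hg.totalDegree_le, by simpa using hα, fun β hβ hle => hg.eval_eq_zero β hle hβ⟩

theorem VanishesOff.eq_zero_of_eval {α : Fin n → ℕ} {g : MvPolynomial (Fin n) F}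
    (hg : VanishesOff α g) (hα : eval (bar (toInt α)) g = 0) : g = 0 :=
  IsNull.eq_zero (S := ∅) (by simp) ⟨hg.totalDegree_le, by simp, fun β _ hle =>
    if h : β = α then h ▸ hα else hg.eval_eq_zero β hle h⟩

theorem VanishesOff.sub {α : Fin n → ℕ} {g g' : MvPolynomial (Fin n) F} (hg : VanishesOff α g)
    (hg' : VanishesOff α g') : VanishesOff α (g - g') where
  totalDegree_le := (totalDegree_sub _ _).trans (max_le hg.totalDegree_le hg'.totalDegree_le)
  eval_eq_zero β hle hβ := by
    rw [map_sub, hg.eval_eq_zero β hle hβ, hg'.eval_eq_zero β hle hβ, sub_zero]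

theorem VanishesOff.C_mul {α : Fin n → ℕ} {g : MvPolynomial (Fin n) F} (hg : VanishesOff α g)
    (c : F) : VanishesOff α (C c * g) where
  totalDegree_le := (totalDegree_mul _ _).trans (by simpa using hg.totalDegree_le)
  eval_eq_zero β hle hβ := by rw [map_mul, hg.eval_eq_zero β hle hβ, mul_zero]

theorem VanishesOff.exists_isInterpolation {α : Fin n → ℕ} {g : MvPolynomial (Fin n) F}
    (hg : VanishesOff α g) (hg0 : g ≠ 0) : ∃ g', IsInterpolation α g' := by
  have h := hg.C_mul (coeff (expo α) g)⁻¹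
  refine ⟨_, h.totalDegree_le, h.eval_eq_zero, ?_⟩
  rw [coeff_C_mul]
  exact inv_mul_cancel₀ fun h0 => hg0 (hg.eq_zero_of_coeff h0)

theorem IsInterpolation.vanishesOff {α : Fin n → ℕ} {g : MvPolynomial (Fin n) F}
    (hg : IsInterpolation α g) : VanishesOff α g :=
  ⟨hg.totalDegree_le, hg.vanishing⟩

theorem IsInterpolation.unique {α : Fin n → ℕ} {g g' : MvPolynomial (Fin n) F}
    (hg : IsInterpolation α g) (hg' : IsInterpolation α g') : g = g' :=
  sub_eq_zero.mp <| (hg.vanishesOff.sub hg'.vanishesOff).eq_zero_of_coeff <| by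
      rw [coeff_sub, hg.coeff_eq_one, hg'.coeff_eq_one, sub_self]

theorem IsInterpolation.eval_bar_ne_zero {α : Fin n → ℕ} {g : MvPolynomial (Fin n) F}
    (hg : IsInterpolation α g) : eval (bar (toInt α)) g ≠ 0 := fun h => by
  have := hg.coeff_eq_one
  rw [hg.vanishesOff.eq_zero_of_eval h, coeff_zero] at this
  exact zero_ne_one this

end Interpolation

/-! ### Demazure–Lusztig operators -/

section Hecke

variable {n m : ℕ}

theorem X_sub_X_dvd_sub_rename_adj {R : Type*} [CommRing R] (i : Fin m)
    (f : MvPolynomial (Fin (m + 1)) R) : X i.castSucc - X i.succ ∣ f - rename (adj i) f := by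
  have hdvd (k : Fin (m + 1)) : (X i.castSucc - X i.succ : MvPolynomial (Fin (m + 1)) R) ∣
      X k - X (adj i k) := by
    by_cases hk : k = i.castSucc
    · simp [hk, adj]
    by_cases hk' : k = i.succ
    · rw [hk', adj, Equiv.swap_apply_right, dvd_sub_comm]
    · simp [adj, Equiv.swap_apply_of_ne_of_ne hk hk']
  have := dvd_aeval_sub_aeval (y := X ∘ adj i) hdvd f
  rwa [aeval_X_left_apply, ← rename_eq_aeval] at this

/-- The divided difference `(f - sᵢ f) / (xᵢ - xᵢ₊₁)`. -/
noncomputable def divDiff {R : Type*} [CommRing R] (i : Fin m) (f : MvPolynomial (Fin (m + 1)) R) :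
    MvPolynomial (Fin (m + 1)) R :=
  (X_sub_X_dvd_sub_rename_adj i f).choose

theorem X_sub_X_mul_divDiff {R : Type*} [CommRing R] (i : Fin m)
    (f : MvPolynomial (Fin (m + 1)) R) :
    (X i.castSucc - X i.succ) * divDiff i f = f - rename (adj i) f :=
  (X_sub_X_dvd_sub_rename_adj i f).choose_spec.symm

theorem totalDegree_X_mul_divDiff_le {R : Type*} [CommRing R] [IsDomain R] (i : Fin m)
    (f : MvPolynomial (Fin (m + 1)) R) :
    (X i.castSucc * divDiff i f).totalDegree ≤ f.totalDegree := by
  by_cases h0 : divDiff i f = 0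
  · simp [h0]
  have hlin : (X i.castSucc - X i.succ : MvPolynomial (Fin (m + 1)) R).totalDegree = 1 := by
    refine totalDegree_X_sub (totalDegree_X _).le ?_
    rw [coeff_X, if_neg]
    exact (Finsupp.single_left_injective one_ne_zero).ne (Fin.castSucc_lt_succ).ne'
  calc (X i.castSucc * divDiff i f).totalDegree
      = (f - rename (adj i) f).totalDegree := by
        rw [← X_sub_X_mul_divDiff, totalDegree_linear_mul hlin h0,
          totalDegree_linear_mul (totalDegree_X _) h0]
    _ ≤ f.totalDegree :=
        (totalDegree_sub _ _).trans (max_le le_rfl (totalDegree_rename_le _ _))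

/-- The Demazure–Lusztig operator `Hᵢ f = t sᵢ f + (t - 1) xᵢ (f - sᵢ f) / (xᵢ - xᵢ₊₁)`. -/
noncomputable def hecke (i : Fin m) (f : MvPolynomial (Fin (m + 1)) F) :
    MvPolynomial (Fin (m + 1)) F :=
  C t * rename (adj i) f + C (t - 1) * (X i.castSucc * divDiff i f)

theorem totalDegree_hecke_le (i : Fin m) (f : MvPolynomial (Fin (m + 1)) F) :
    (hecke i f).totalDegree ≤ f.totalDegree := by
  refine (totalDegree_add _ _).trans (max_le ?_ ?_) <;> refine (totalDegree_mul _ _).trans ?_ <;>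
    rw [totalDegree_C, zero_add]
  · exact totalDegree_rename_le _ _
  · exact totalDegree_X_mul_divDiff_le i f

theorem aeval_hecke {L : Type*} [Field L] [Algebra F L] {x : Fin (m + 1) → L} {i : Fin m}
    (hx : x i.castSucc ≠ x i.succ) (f : MvPolynomial (Fin (m + 1)) F) :
    aeval x (hecke i f) =
      (algebraMap F L t - 1) * x i.castSucc / (x i.castSucc - x i.succ) * aeval x f +
      (algebraMap F L t - (algebraMap F L t - 1) * x i.castSucc / (x i.castSucc - x i.succ)) *
        aeval (x ∘ adj i) f := by
  have hx' := sub_ne_zero.mpr hx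
  have hdivDiff : aeval x (divDiff i f) =
      (aeval x f - aeval (x ∘ adj i) f) / (x i.castSucc - x i.succ) := by
    have := congrArg (aeval x) (X_sub_X_mul_divDiff i f)
    simp only [map_mul, map_sub, aeval_X, aeval_rename] at this
    rw [← this, mul_div_cancel_left₀ _ hx']
  simp only [hecke, map_add, map_mul, map_sub, aeval_X, aeval_C, aeval_rename, map_one, hdivDiff]
  ring

/-- The coefficient of `f(v̄)` in `(Hᵢ f)(v̄)`. -/
noncomputable def heckeCoeff (v : Fin (m + 1) → ℤ) (i : Fin m) : F :=
  (t - 1) * bar v i.castSucc / (bar v i.castSucc - bar v i.succ)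

theorem heckeCoeff_eq_t_iff {v : Fin (m + 1) → ℤ} {i : Fin m} :
    heckeCoeff v i = t ↔ v i.castSucc = v i.succ := by
  rw [heckeCoeff, div_eq_iff (sub_ne_zero.mpr (bar_castSucc_ne_bar_succ v i))]
  refine ⟨fun h => ?_, fun hv => by rw [bar_castSucc_of_eq hv]; ring⟩
  by_contra hv
  refine bar_ne_t_zpow_mul_bar v hv 1 ?_
  rw [zpow_one]
  linear_combination -h

theorem aeval_scale_bar_hecke {L : Type*} [Field L] [Algebra F L] {s : L} (hs : s ≠ 0)
    (v : Fin (m + 1) → ℤ) (i : Fin m) (f : MvPolynomial (Fin (m + 1)) F) :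
    aeval (scale s (bar v)) (hecke i f) =
      algebraMap F L (heckeCoeff v i) * aeval (scale s (bar v)) f +
      algebraMap F L (t - heckeCoeff v i) * aeval (scale s (bar (v ∘ adj i))) f := by
  have hne : scale s (bar v) i.castSucc ≠ scale s (bar v) i.succ := fun h =>
    bar_castSucc_ne_bar_succ v i ((algebraMap F L).injective (mul_left_cancel₀ hs h))
  have hcoeff : (algebraMap F L t - 1) * scale s (bar v) i.castSucc /
      (scale s (bar v) i.castSucc - scale s (bar v) i.succ) = algebraMap F L (heckeCoeff v i) := by
    simp only [heckeCoeff, scale, map_div₀, map_mul, map_sub, map_one]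
    rw [← mul_sub, mul_left_comm, mul_div_mul_left _ _ hs]
  rw [aeval_hecke hne, hcoeff, ← map_sub]
  by_cases hv : v i.castSucc = v i.succ
  · rw [heckeCoeff_eq_t_iff.mpr hv, sub_self, map_zero, zero_mul, zero_mul]
  · rw [bar_comp_adj hv]
    rfl

theorem eval_bar_hecke (w : Fin (m + 1) → ℕ) (i : Fin m) (f : MvPolynomial (Fin (m + 1)) F) :
    eval (bar (toInt w)) (hecke i f) =
      heckeCoeff (toInt w) i * eval (bar (toInt w)) f +
      (t - heckeCoeff (toInt w) i) * eval (bar (toInt (w ∘ adj i))) f := by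
  simp only [← aeval_scale_one]
  exact aeval_scale_bar_hecke one_ne_zero (toInt w) i f

end Hecke

/-! ### Existence and recursions of `G` -/

section Recursions

variable {n m : ℕ}

theorem VanishesOff.phi {u : Fin (m + 1) → ℕ} {g : MvPolynomial (Fin (m + 1)) F}
    (hg : VanishesOff u g) : VanishesOff (raise u) (phi g) where
  totalDegree_le := (totalDegree_phi_le g).trans
    ((size_raise u).symm ▸ Nat.succ_le_succ hg.totalDegree_le)
  eval_eq_zero w hle hw := by
    by_cases hlast : w (Fin.last m) = 0
    · exact eval_bar_phi_of_last_eq_zero hlast g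
    obtain ⟨w, rfl⟩ := exists_eq_raise hlast
    rw [size_raise, size_raise] at hle
    exact eval_bar_raise_phi_eq_zero_iff.mpr
      (hg.eval_eq_zero w (Nat.succ_le_succ_iff.mp hle) fun h => hw (h ▸ rfl))

theorem VanishesOff.hecke_sub {u : Fin (m + 1) → ℕ} {g : MvPolynomial (Fin (m + 1)) F}
    (hg : VanishesOff u g) (i : Fin m) :
    VanishesOff (u ∘ adj i) (hecke i g - C (heckeCoeff (toInt u) i) * g) where
  totalDegree_le := by
    rw [size_comp_adj]
    refine (totalDegree_sub _ _).trans (max_le ?_ (hg.C_mul _).totalDegree_le)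
    exact (totalDegree_hecke_le i g).trans hg.totalDegree_le
  eval_eq_zero w hle hw := by
    rw [size_comp_adj] at hle
    have hne : w ∘ adj i ≠ u := by
      rintro rfl
      exact hw (comp_adj_comp_adj w i).symm
    have hdiag :
        (heckeCoeff (toInt w) i - heckeCoeff (toInt u) i) * eval (bar (toInt w)) g = 0 := by
      by_cases h : w = u
      · rw [h, sub_self, zero_mul]
      · rw [hg.eval_eq_zero w hle h, mul_zero]
    rw [map_sub, eval_bar_hecke, map_mul, eval_C, hg.eval_eq_zero _ (by rwa [size_comp_adj]) hne]
    linear_combination hdiag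

theorem isInterpolation_zero : IsInterpolation (0 : Fin n → ℕ) 1 where
  totalDegree_le := by simp
  vanishing β hle hβ := by
    have hsize : size β = 0 := Nat.le_zero.mp (hle.trans_eq (Finset.sum_eq_zero fun _ _ => rfl))
    exact absurd (funext fun i => Finset.sum_eq_zero_iff.mp hsize i (Finset.mem_univ i)) hβ
  coeff_eq_one := by
    rw [show Finsupp.equivFunOnFinite.symm (0 : Fin n → ℕ) = 0 from Finsupp.ext fun _ => rfl,
      coeff_zero_one]

theorem exists_isInterpolation_raise {u : Fin (m + 1) → ℕ} (h : ∃ g, IsInterpolation u g) :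
    ∃ g, IsInterpolation (raise u) g := by
  obtain ⟨g, hg⟩ := h
  refine hg.vanishesOff.phi.exists_isInterpolation fun h0 => ?_
  exact hg.eval_bar_ne_zero
    (eval_bar_raise_phi_eq_zero_iff.mp (by rw [h0, map_zero]))

theorem exists_isInterpolation_comp_adj {u : Fin (m + 1) → ℕ} (h : ∃ g, IsInterpolation u g)
    (i : Fin m) : ∃ g, IsInterpolation (u ∘ adj i) g := by
  by_cases hu : u i.castSucc = u i.succ
  · rwa [comp_adj_eq_self hu]
  obtain ⟨g, hg⟩ := h
  refine (hg.vanishesOff.hecke_sub i).exists_isInterpolation fun h0 => ?_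
  have hswap : heckeCoeff (toInt (u ∘ adj i)) i ≠ t := fun h => hu <| by
    simpa [toInt, adj] using (heckeCoeff_eq_t_iff.mp h).symm
  have hoff : eval (bar (toInt (u ∘ adj i))) g = 0 := by
    refine hg.vanishing _ (size_comp_adj u i).le fun h => hu ?_
    simpa [adj] using (congrFun h i.castSucc).symm
  have := congrArg (eval (bar (toInt (u ∘ adj i)))) h0
  rw [map_sub, eval_bar_hecke, map_mul, hoff, comp_adj_comp_adj, map_zero, mul_zero, mul_zero,
    zero_add, sub_zero] at this
  exact mul_ne_zero (sub_ne_zero.mpr hswap.symm) hg.eval_bar_ne_zero this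

theorem exists_isInterpolation : ∀ {n : ℕ} (α : Fin n → ℕ), ∃ g, IsInterpolation α g
  | 0, α => Subsingleton.elim 0 α ▸ ⟨1, isInterpolation_zero⟩
  | _ + 1, α => by
    induction α using composition_induction with
    | zero => exact ⟨1, isInterpolation_zero⟩
    | raise u ih => exact exists_isInterpolation_raise ih
    | swap u i ih => exact exists_isInterpolation_comp_adj ih i

theorem existsUnique_isInterpolation (α : Fin n → ℕ) : ∃! g, IsInterpolation α g :=
  existsUnique_of_exists_of_unique (exists_isInterpolation α) fun _ _ => IsInterpolation.unique

theorem isInterpolation_G (α : Fin n → ℕ) : IsInterpolation α (G α) :=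
  Classical.epsilon_spec (exists_isInterpolation α)

theorem vanishesOff_G (α : Fin n → ℕ) : VanishesOff α (G α) :=
  (isInterpolation_G α).vanishesOff

theorem VanishesOff.eq_C_coeff_mul_G {α : Fin n → ℕ} {g : MvPolynomial (Fin n) F}
    (hg : VanishesOff α g) : g = C (coeff (expo α) g) * G α :=
  sub_eq_zero.mp <| (hg.sub ((vanishesOff_G α).C_mul _)).eq_zero_of_coeff <| by
    rw [coeff_sub, coeff_C_mul, (isInterpolation_G α).coeff_eq_one, mul_one, sub_self]

theorem G_zero : G (0 : Fin n → ℕ) = 1 :=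
  (isInterpolation_G 0).unique isInterpolation_zero

theorem phi_G (u : Fin (m + 1) → ℕ) : phi (G u) = C (q⁻¹ ^ u 0) * G (raise u) := by
  rw [(vanishesOff_G u).phi.eq_C_coeff_mul_G, coeff_raise_phi (vanishesOff_G u).totalDegree_le,
    (isInterpolation_G u).coeff_eq_one, mul_one]

theorem exists_hecke_G_eq (u : Fin (m + 1) → ℕ) (i : Fin m) :
    ∃ κ, hecke i (G u) = C (heckeCoeff (toInt u) i) * G u + C κ * G (u ∘ adj i) :=
  ⟨_, eq_add_of_sub_eq' ((vanishesOff_G u).hecke_sub i).eq_C_coeff_mul_G⟩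

end Recursions

/-! ### The Cherednik eigenvalue equation -/

section Cherednik

variable {m : ℕ}

/-- The composite `Hⱼ Hⱼ₊₁ ⋯ Hₙ₋₁` of Demazure–Lusztig operators. -/
noncomputable def heckeChain (j : Fin (m + 1)) (f : MvPolynomial (Fin (m + 1)) F) :
    MvPolynomial (Fin (m + 1)) F :=
  Fin.reverseInduction (motive := fun _ => MvPolynomial (Fin (m + 1)) F) f hecke j

@[simp] theorem heckeChain_last (f : MvPolynomial (Fin (m + 1)) F) :
    heckeChain (Fin.last m) f = f :=
  Fin.reverseInduction_last

@[simp] theorem heckeChain_castSucc (i : Fin m) (f : MvPolynomial (Fin (m + 1)) F) :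
    heckeChain i.castSucc f = hecke i (heckeChain i.succ f) :=
  Fin.reverseInduction_castSucc _

theorem totalDegree_heckeChain_le (j : Fin (m + 1)) (f : MvPolynomial (Fin (m + 1)) F) :
    (heckeChain j f).totalDegree ≤ f.totalDegree := by
  induction j using Fin.reverseInduction with
  | last => rw [heckeChain_last]
  | cast i ih =>
    rw [heckeChain_castSucc]
    exact (totalDegree_hecke_le _ _).trans ih

theorem eval_bar_heckeChain_eq_zero {d : ℕ} {f : MvPolynomial (Fin (m + 1)) F}
    (hf : ∀ w, size w ≤ d → eval (bar (toInt w)) f = 0) (j : Fin (m + 1)) :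
    ∀ w, size w ≤ d → eval (bar (toInt w)) (heckeChain j f) = 0 := by
  induction j using Fin.reverseInduction with
  | last => rwa [heckeChain_last]
  | cast i ih =>
    intro w hw
    rw [heckeChain_castSucc, eval_bar_hecke, ih w hw, ih _ ((size_comp_adj w i).trans_le hw),
      mul_zero, mul_zero, add_zero]

theorem X_castSucc_dvd_hecke_sub (i : Fin m) (f : MvPolynomial (Fin (m + 1)) F) :
    X i.castSucc ∣ hecke i f - C t * rename (adj i) f :=
  ⟨C (t - 1) * divDiff i f, by rw [hecke]; ring⟩

/-- The substitution of indices under which `(x₁, …, xₙ)` becomes `(x₁, …, x̂ⱼ, …, xₙ, xⱼ)`. -/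
def moveToEnd (j : Fin (m + 1)) : Fin (m + 1) → Fin (m + 1) :=
  Fin.snoc (α := fun _ => Fin (m + 1)) j.succAbove j

theorem moveToEnd_last : moveToEnd (Fin.last m) = id := by
  ext1 i
  refine Fin.lastCases ?_ (fun i => ?_) i <;> simp [moveToEnd]

theorem adj_comp_moveToEnd_succ (i : Fin m) :
    adj i ∘ moveToEnd i.succ = moveToEnd i.castSucc := by
  ext1 k
  refine Fin.lastCases ?_ (fun k => ?_) k
  · simp [moveToEnd, adj]
  · simp only [moveToEnd, Fin.snoc_castSucc, Function.comp, adj, Equiv.swap_apply_def,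
      Fin.succAbove]
    grind

theorem X_dvd_heckeChain_sub (j : Fin (m + 1)) (f : MvPolynomial (Fin (m + 1)) F) :
    X j ∣ heckeChain j f - C (t ^ (m - (j : ℕ))) * rename (moveToEnd j) f := by
  induction j using Fin.reverseInduction with
  | last => simp [moveToEnd_last]
  | cast i ih =>
    have hadj := map_dvd (rename (adj i) : _ →ₐ[F] MvPolynomial (Fin (m + 1)) F) ih
    rw [map_sub, map_mul, rename_X, rename_C, rename_rename, adj_comp_moveToEnd_succ,
      Equiv.swap_apply_right] at hadj
    have hexp : m - (i.castSucc : ℕ) = m - (i.succ : ℕ) + 1 := by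
      simp only [Fin.val_succ, Fin.val_castSucc]
      omega
    convert dvd_add (X_castSucc_dvd_hecke_sub i (heckeChain i.succ f))
      (hadj.mul_left (C t)) using 1
    rw [heckeChain_castSucc, hexp, pow_succ', C_mul]
    ring

theorem X_zero_dvd_add_heckeChain_phi (f : MvPolynomial (Fin (m + 1)) F) :
    X 0 ∣ f + heckeChain 0 (phi f) := by
  let dilated : Fin (m + 1) → MvPolynomial (Fin (m + 1)) F := shiftPoint (X ∘ moveToEnd 0)
  have hrename : rename (moveToEnd 0) (phi f) =
      (X 0 - C (t ^ (-(m : ℤ)))) * aeval dilated f := by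
    rw [rename_eq_aeval, aeval_phi, Function.comp_apply, moveToEnd, Fin.snoc_last, algebraMap_eq]
    rfl
  have hdilated : X 0 ∣ f - aeval dilated f := by
    have hX (i : Fin (m + 1)) : (X 0 : MvPolynomial (Fin (m + 1)) F) ∣ X i - dilated i := by
      refine Fin.cases ?_ (fun i => ?_) i
      · exact dvd_sub dvd_rfl (by simp [dilated, shiftPoint, moveToEnd])
      · simp [dilated, shiftPoint, moveToEnd, Fin.init]
    simpa only [aeval_X_left_apply] using dvd_aeval_sub_aeval hX f
  have hcancel : (C (t ^ m) * C (t ^ (-(m : ℤ))) : MvPolynomial (Fin (m + 1)) F) = 1 := by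
    rw [← C_mul, zpow_neg, zpow_natCast, mul_inv_cancel₀ (pow_ne_zero m t_ne_zero), C_1]
  have hchain := X_dvd_heckeChain_sub 0 (phi f)
  rw [hrename, Fin.val_zero, Nat.sub_zero] at hchain
  convert dvd_add (dvd_add hchain hdilated) (dvd_mul_right (X 0) (C (t ^ m) * aeval dilated f))
    using 1
  linear_combination (-aeval dilated f) * hcancel

theorem G_add_heckeChain_phi_G (v : Fin (m + 1) → ℕ) :
    G v + heckeChain 0 (phi (G v)) = X 0 * (C (bar (toInt v) 0)⁻¹ * G v) := by
  obtain ⟨p, hp⟩ := X_zero_dvd_add_heckeChain_phi (G v)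
  have hphi (w) (hw : size w ≤ size v) : eval (bar (toInt w)) (phi (G v)) = 0 := by
    have hlt : size w < size (raise v) := size_raise v ▸ Nat.lt_succ_of_le hw
    exact (vanishesOff_G v).phi.eval_eq_zero w hlt.le (ne_of_apply_ne size hlt.ne)
  have hvalue (w) (hw : size w ≤ size v) :
      eval (bar (toInt w)) (G v) = bar (toInt w) 0 * eval (bar (toInt w)) p := by
    have := congrArg (eval (bar (toInt w))) hp
    rwa [map_add, map_mul, eval_X, eval_bar_heckeChain_eq_zero hphi 0 w hw, add_zero] at this
  have hdeg : p.totalDegree ≤ size v := by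
    by_cases hp0 : p = 0
    · simp [hp0]
    have hG := (vanishesOff_G v).totalDegree_le
    have hchain := (totalDegree_heckeChain_le 0 (phi (G v))).trans (totalDegree_phi_le _)
    have hsum := totalDegree_add (G v) (heckeChain 0 (phi (G v)))
    rw [hp, totalDegree_linear_mul (totalDegree_X _) hp0] at hsum
    omega
  have hpvan : VanishesOff v p := ⟨hdeg, fun w hw hne => by
    have := hvalue w hw
    rw [(vanishesOff_G v).eval_eq_zero w hw hne] at this
    exact (mul_eq_zero.mp this.symm).resolve_left (bar_ne_zero _ _)⟩
  rw [hp, ← sub_eq_zero.mp ((hpvan.sub ((vanishesOff_G v).C_mul _)).eq_zero_of_eval _)]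
  rw [map_sub, map_mul, eval_C, hvalue v le_rfl, inv_mul_cancel_left₀ (bar_ne_zero _ _), sub_self]

end Cherednik

/-! ### Duality -/

section Duality

variable {n m : ℕ}

/-- The value `a / v̄₁ - 1`, through which the raising operator acts at `a τ` and at `a ṽ`. -/
noncomputable def eigenFactor (v : Fin (m + 1) → ℤ) : K :=
  a * algebraMap F K (bar v 0)⁻¹ - 1

theorem eigenFactor_ne_zero (v : Fin (m + 1) → ℤ) : eigenFactor v ≠ 0 := by
  intro h
  have ha : a = algebraMap F K (bar v 0) := by
    rwa [eigenFactor, map_inv₀, ← div_eq_mul_inv, sub_eq_zero,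
      div_eq_one_iff_eq ((map_ne_zero _).mpr (bar_ne_zero v 0))] at h
  exact RatFunc.transcendental_X (ha ▸ isAlgebraic_algebraMap _)

theorem aeval_tau_hecke (i : Fin m) (f : MvPolynomial (Fin (m + 1)) F) :
    aeval (aMul tau) (hecke i f) = algebraMap F K t * aeval (aMul tau) f := by
  have h := aeval_scale_bar_hecke (L := K) (s := a) RatFunc.X_ne_zero 0 i f
  rw [heckeCoeff_eq_t_iff.mpr rfl, sub_self, map_zero, zero_mul, add_zero, bar_zero] at h
  exact h

theorem aeval_tau_heckeChain (j : Fin (m + 1)) (f : MvPolynomial (Fin (m + 1)) F) :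
    aeval (aMul tau) (heckeChain j f) =
      algebraMap F K t ^ (m - (j : ℕ)) * aeval (aMul tau) f := by
  induction j using Fin.reverseInduction with
  | last => simp
  | cast i ih =>
    have hexp : m - (i.castSucc : ℕ) = m - (i.succ : ℕ) + 1 := by
      simp only [Fin.val_succ, Fin.val_castSucc]
      omega
    rw [heckeChain_castSucc, aeval_tau_hecke, ih, hexp, pow_succ', mul_assoc]

theorem aeval_tau_phi_G (u : Fin (m + 1) → ℕ) :
    aeval (aMul tau) (phi (G u)) =
      algebraMap F K (t ^ (-(m : ℤ))) * eigenFactor (toInt u) * GatTau u := by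
  have htau : aMul (tau : Fin (m + 1) → F) 0 = a := by simp [aMul, tau]
  have h := congrArg (aeval (aMul tau)) (G_add_heckeChain_phi_G u)
  rw [map_add, map_mul, map_mul, aeval_tau_heckeChain, aeval_X, aeval_C, htau, ← GatTau,
    Fin.val_zero, Nat.sub_zero] at h
  have ht : algebraMap F K t ^ m ≠ 0 := pow_ne_zero m ((map_ne_zero _).mpr t_ne_zero)
  refine mul_left_cancel₀ ht ?_
  rw [zpow_neg, zpow_natCast, map_inv₀, map_pow, mul_assoc, mul_inv_cancel_left₀ ht, eigenFactor]
  linear_combination h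

theorem neg_w0_eq_raise (v : Fin (m + 1) → ℤ) : -w0 v = raise (-w0 (raise v)) := by
  ext i
  refine Fin.lastCases ?_ (fun i => ?_) i <;> simp [w0, Fin.rev_castSucc, Fin.rev_succ]

theorem aeval_tilde_phi (v : Fin (m + 1) → ℤ) (f : MvPolynomial (Fin (m + 1)) F) :
    aeval (aMul (tilde v)) (phi f) =
      algebraMap F K (t ^ (-(m : ℤ))) * eigenFactor v * aeval (aMul (tilde (raise v))) f := by
  have hlast : q * bar (-w0 (raise v)) 0 = t ^ (-(m : ℤ)) * (bar v 0)⁻¹ := by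
    rw [← bar_raise_last, ← neg_w0_eq_raise, ← tilde, tilde_eq_inv_bar, Fin.rev_last]
    congr 2
    push_cast
    ring
  have h := aeval_scale_bar_raise_phi a (-w0 (raise v)) f
  rw [← neg_w0_eq_raise, hlast] at h
  refine h.trans (congrArg (· * _) ?_)
  rw [eigenFactor, map_mul]
  ring

theorem neg_w0_comp_adj (v : Fin (m + 1) → ℤ) (i : Fin m) :
    (-w0 v) ∘ adj i = -w0 (v ∘ adj i.rev) := by
  have hrev (j : Fin (m + 1)) : (adj i j).rev = adj i.rev j.rev := by
    rw [adj, adj, Fin.rev_injective.map_swap, Fin.rev_castSucc, Fin.rev_succ, Equiv.swap_comm]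
  ext j
  simp only [Function.comp_apply, Pi.neg_apply, w0, hrev]

theorem heckeCoeff_neg_w0 (v : Fin (m + 1) → ℤ) (i : Fin m) :
    heckeCoeff (-w0 v) i = heckeCoeff v i.rev := by
  have hcastSucc := bar_ne_zero v i.rev.castSucc
  have hsucc := bar_ne_zero v i.rev.succ
  have hsub := sub_ne_zero.mpr (bar_castSucc_ne_bar_succ v i.rev)
  rw [heckeCoeff, heckeCoeff, ← tilde, tilde_eq_inv_bar, tilde_eq_inv_bar, Fin.rev_castSucc,
    Fin.rev_succ, ← mul_sub, mul_left_comm, mul_div_mul_left _ _ (zpow_ne_zero _ t_ne_zero),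
    inv_sub_inv hsucc hcastSucc]
  field_simp

theorem aeval_tilde_hecke (v : Fin (m + 1) → ℤ) (i : Fin m) (f : MvPolynomial (Fin (m + 1)) F) :
    aeval (aMul (tilde v)) (hecke i f) =
      algebraMap F K (heckeCoeff v i.rev) * aeval (aMul (tilde v)) f +
      algebraMap F K (t - heckeCoeff v i.rev) * aeval (aMul (tilde (v ∘ adj i.rev))) f := by
  have h := aeval_scale_bar_hecke (L := K) (s := a) RatFunc.X_ne_zero (-w0 v) i f
  rw [heckeCoeff_neg_w0, neg_w0_comp_adj] at h
  exact h

theorem GatTau_zero : GatTau (0 : Fin n → ℕ) = 1 := by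
  rw [GatTau, G_zero, map_one]

theorem GatTau_raise (u : Fin (m + 1) → ℕ) :
    algebraMap F K (q⁻¹ ^ u 0) * GatTau (raise u) =
      algebraMap F K (t ^ (-(m : ℤ))) * eigenFactor (toInt u) * GatTau u := by
  rw [← aeval_tau_phi_G, phi_G, map_mul, aeval_C, GatTau]

theorem mul_GatTau_comp_adj {u : Fin (m + 1) → ℕ} {i : Fin m} {κ : F}
    (hκ : hecke i (G u) = C (heckeCoeff (toInt u) i) * G u + C κ * G (u ∘ adj i)) :
    algebraMap F K κ * GatTau (u ∘ adj i) =
      algebraMap F K (t - heckeCoeff (toInt u) i) * GatTau u := by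
  have h := congrArg (aeval (aMul tau)) hκ
  rw [aeval_tau_hecke, map_add, map_mul, map_mul, aeval_C, aeval_C] at h
  rw [map_sub, GatTau, GatTau]
  linear_combination -h

theorem sub_heckeCoeff_ne_zero {u : Fin (m + 1) → ℕ} {i : Fin m}
    (hu : u i.castSucc ≠ u i.succ) : algebraMap F K (t - heckeCoeff (toInt u) i) ≠ 0 :=
  (map_ne_zero _).mpr <| sub_ne_zero.mpr fun h =>
    hu (Nat.cast_injective (heckeCoeff_eq_t_iff.mp h.symm))

theorem GatTau_ne_zero : ∀ {n : ℕ} (u : Fin n → ℕ), GatTau u ≠ 0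
  | 0, u => by
    rw [Subsingleton.elim u 0, GatTau_zero]
    exact one_ne_zero
  | m + 1, u => by
    induction u using composition_induction with
    | zero =>
      rw [GatTau_zero]
      exact one_ne_zero
    | raise u hu =>
      refine right_ne_zero_of_mul (a := algebraMap F K (q⁻¹ ^ u 0)) ?_
      rw [GatTau_raise]
      exact mul_ne_zero (mul_ne_zero ((map_ne_zero _).mpr (zpow_ne_zero _ t_ne_zero))
        (eigenFactor_ne_zero _)) hu
    | swap u i hu =>
      by_cases h : u i.castSucc = u i.succ
      · rwa [comp_adj_eq_self h]
      · obtain ⟨κ, hκ⟩ := exists_hecke_G_eq u i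
        refine right_ne_zero_of_mul (a := algebraMap F K κ) ?_
        rw [mul_GatTau_comp_adj hκ]
        exact mul_ne_zero (sub_heckeCoeff_ne_zero h) hu

/-- The normalized value `K_u(a ṽ) = G_u(a ṽ) / G_u(a τ)`. -/
noncomputable def normValue (u v : Fin n → ℕ) : K :=
  aeval (aMul (tilde (toInt v))) (G u) / GatTau u

theorem normValue_zero_left (v : Fin n → ℕ) : normValue 0 v = 1 := by
  rw [normValue, G_zero, map_one, GatTau_zero, div_one]

theorem normValue_zero_right (u : Fin n → ℕ) : normValue u 0 = 1 := by
  rw [normValue, show toInt (0 : Fin n → ℕ) = 0 from rfl, tilde_zero, ← GatTau,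
    div_self (GatTau_ne_zero u)]

theorem eigenFactor_mul_normValue_raise (u v : Fin (m + 1) → ℕ) :
    eigenFactor (toInt u) * normValue (raise u) v =
      eigenFactor (toInt v) * normValue u (raise v) := by
  have hq : algebraMap F K (q⁻¹ ^ u 0) ≠ 0 :=
    (map_ne_zero _).mpr (pow_ne_zero _ (inv_ne_zero q_ne_zero))
  have hvalue := aeval_tilde_phi (toInt v) (G u)
  rw [phi_G, map_mul, aeval_C] at hvalue
  rw [normValue, normValue, mul_div_assoc', mul_div_assoc',
    div_eq_div_iff (GatTau_ne_zero _) (GatTau_ne_zero _), toInt_raise]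
  refine mul_left_cancel₀ hq ?_
  linear_combination eigenFactor (toInt u) * GatTau u * hvalue -
    eigenFactor (toInt v) * aeval (aMul (tilde (raise (toInt v)))) (G u) * GatTau_raise u

theorem normValue_swap (u v : Fin (m + 1) → ℕ) (i : Fin m) :
    algebraMap F K (heckeCoeff (toInt u) i) * normValue u v +
      algebraMap F K (t - heckeCoeff (toInt u) i) * normValue (u ∘ adj i) v =
    algebraMap F K (heckeCoeff (toInt v) i.rev) * normValue u v +
      algebraMap F K (t - heckeCoeff (toInt v) i.rev) * normValue u (v ∘ adj i.rev) := by
  obtain ⟨κ, hκ⟩ := exists_hecke_G_eq u i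
  have hprincipal := mul_GatTau_comp_adj hκ
  have hvalue := aeval_tilde_hecke (toInt v) i (G u)
  rw [hκ, map_add, map_mul, map_mul, aeval_C, aeval_C] at hvalue
  have hu := GatTau_ne_zero u
  have hadj := GatTau_ne_zero (u ∘ adj i)
  have hcomp : toInt (v ∘ adj i.rev) = toInt v ∘ adj i.rev := rfl
  rw [normValue, normValue, normValue, hcomp]
  field_simp
  linear_combination GatTau (u ∘ adj i) * hvalue -
    aeval (aMul (tilde (toInt v))) (G (u ∘ adj i)) * hprincipal

theorem normValue_comm : ∀ {n : ℕ} (u v : Fin n → ℕ), normValue u v = normValue v u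
  | 0, u, v => by rw [Subsingleton.elim u v]
  | m + 1, u, v => by
    induction u using composition_induction generalizing v with
    | zero => rw [normValue_zero_left, normValue_zero_right]
    | raise u ih =>
      refine mul_left_cancel₀ (eigenFactor_ne_zero (toInt u)) ?_
      rw [eigenFactor_mul_normValue_raise, ih, eigenFactor_mul_normValue_raise]
    | swap u i ih =>
      by_cases h : u i.castSucc = u i.succ
      · rw [comp_adj_eq_self h, ih]
      · have hv := normValue_swap v u i.rev
        rw [Fin.rev_rev, ← ih v, ← ih (v ∘ adj i.rev)] at hv
        refine mul_left_cancel₀ (sub_heckeCoeff_ne_zero h) ?_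
        linear_combination normValue_swap u v i + hv

end Duality

/-! ### The polynomials `O_α` -/

section DualPolynomials

variable {n : ℕ}

theorem eq_zero_of_eval_inv_bar {L : Type*} [Field L] [Algebra F L] {p : MvPolynomial (Fin n) L}
    (h : ∀ β : Fin n → ℕ, eval (fun i => algebraMap F L (bar (toInt β) i)⁻¹) p = 0) : p = 0 := by
  -- The entries of `β` run through disjoint intervals, in decreasing order: then `k_i(β)` is
  -- constant, and the points `β̄⁻¹` form a grid with `deg p + 1` values in each direction.
  classical
  set d := p.totalDegree
  let entry (i : Fin n) (j : ℕ) : ℕ := j + (d + 1) * i.rev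
  let z (i : Fin n) (j : ℕ) : L :=
    algebraMap F L (q ^ (entry i j : ℤ) * t ^ (-((i : ℕ) : ℤ)))⁻¹
  have hz (i : Fin n) : Function.Injective (z i) := fun j k hjk =>
    have hexp := (zpow_mul_zpow_inj (inv_injective ((algebraMap F L).injective hjk))).1
    Nat.add_right_cancel (Nat.cast_injective hexp)
  have hbar {j : Fin n → ℕ} (hj : ∀ i, j i < d + 1) (i : Fin n) :
      algebraMap F L (bar (toInt fun i => entry i (j i)) i)⁻¹ = z i (j i) := by
    have hanti : StrictAnti (toInt fun i => entry i (j i)) := fun i k hik => by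
      have hrev : (k.rev : ℕ) + 1 ≤ i.rev := Fin.rev_lt_rev.mpr hik
      have := Nat.mul_le_mul_left (d + 1) hrev
      have := hj k
      simp only [toInt, entry, Nat.cast_lt]
      rw [mul_add] at *
      omega
    rw [bar, kNum_of_antitone hanti.antitone]
    rfl
  refine eq_zero_of_eval_zero_at_prod_finset p (fun i => (Finset.range (d + 1)).image (z i))
    (fun i => ?_) fun x hx => ?_
  · rw [Finset.card_image_of_injective _ (hz i), Finset.card_range]
    exact Nat.lt_succ_of_le (degreeOf_le_totalDegree p i)
  · simp only [Finset.mem_image, Finset.mem_range] at hx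
    choose j hj hjx using hx
    rw [← funext hjx, ← funext (hbar hj)]
    exact h _

theorem aeval_scaledReversal_KPoly (α : Fin n → ℕ) :
    aeval (scaledReversal n) (KPoly α) =
      C (GatTau α)⁻¹ * aeval (scaledReversal n) (G α) := by
  rw [KPoly, map_mul, aeval_C, aeval_map_algebraMap, algebraMap_eq]

theorem eval_inv_bar_scaledReversal (v : Fin n → ℤ) (i : Fin n) :
    eval (fun i => algebraMap F K (bar v i)⁻¹) (scaledReversal n i) = aMul (tilde v) i := by
  rw [scaledReversal, aMul, tilde_eq_inv_bar, map_mul, eval_C, eval_X, map_mul]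
  ring

theorem eval_inv_bar_aeval_scaledReversal (v : Fin n → ℤ) (f : MvPolynomial (Fin n) F) :
    eval (fun i => algebraMap F K (bar v i)⁻¹) (aeval (scaledReversal n) f) =
      aeval (aMul (tilde v)) f := by
  rw [← funext (eval_inv_bar_scaledReversal v), ← aeval_eq_eval]
  exact comp_aeval_apply (scaledReversal n)
    ((aeval fun i => algebraMap F K (bar v i)⁻¹ :
      MvPolynomial (Fin n) K →ₐ[K] K).restrictScalars F) f

theorem isO_scaledReversal (α : Fin n → ℕ) : IsO α (aeval (scaledReversal n) (KPoly α)) where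
  totalDegree_le := by
    have hmap : (map (algebraMap F K) (G α)).totalDegree ≤ (G α).totalDegree :=
      Finset.sup_mono (support_map_subset _ _)
    refine (totalDegree_aeval_le (fun i => ?_) _).trans ?_
    · exact (totalDegree_mul _ _).trans (by rw [totalDegree_C, totalDegree_X])
    · refine (totalDegree_mul _ _).trans ?_
      rw [totalDegree_C, zero_add]
      exact hmap.trans (isInterpolation_G α).totalDegree_le
  eval_eq β := by
    rw [aeval_scaledReversal_KPoly, map_mul, eval_C, eval_inv_bar_aeval_scaledReversal,
      inv_mul_eq_div]
    exact normValue_comm α β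

theorem existsUnique_isO (α : Fin n → ℕ) : ∃! p, IsO α p := by
  refine ⟨_, isO_scaledReversal α, fun p hp => sub_eq_zero.mp (eq_zero_of_eval_inv_bar ?_)⟩
  intro β
  rw [map_sub, hp.eval_eq, (isO_scaledReversal α).eval_eq, sub_self]

theorem O_eq (α : Fin n → ℕ) : O α = aeval (scaledReversal n) (KPoly α) :=
  (existsUnique_isO α).unique (Classical.epsilon_spec (existsUnique_isO α).exists)
    (isO_scaledReversal α)

end DualPolynomials

end InterpolationMacdonald

theorem theoremC (n : ℕ) (α : Fin n → ℕ) :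
    (∃! g : MvPolynomial (Fin n) InterpolationMacdonald.F,
      InterpolationMacdonald.IsInterpolation α g) ∧
    InterpolationMacdonald.GatTau α ≠ 0 ∧
    (∃! p : MvPolynomial (Fin n) InterpolationMacdonald.K, InterpolationMacdonald.IsO α p) ∧
    InterpolationMacdonald.O α =
      MvPolynomial.aeval (InterpolationMacdonald.scaledReversal n)
        (InterpolationMacdonald.KPoly α) ∧
    InterpolationMacdonald.O α =
      MvPolynomial.C (InterpolationMacdonald.GatTau α)⁻¹ *
        MvPolynomial.aeval (InterpolationMacdonald.scaledReversal n)
          (InterpolationMacdonald.G α) :=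
  ⟨InterpolationMacdonald.existsUnique_isInterpolation α,
    InterpolationMacdonald.GatTau_ne_zero α,
    InterpolationMacdonald.existsUnique_isO α,
    InterpolationMacdonald.O_eq α,
    (InterpolationMacdonald.O_eq α).trans
      (InterpolationMacdonald.aeval_scaledReversal_KPoly α)⟩
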